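/- Let $K\ge 1$, let $\alpha=(\alpha_1,\dots,\alpha_K)$ with all $\alpha_i>0$, put $\alpha_0=\sum_{i=1}^K\alpha_i$, and let $\mathbf p\sim\operatorname{Dir}(\alpha)$, i.e. $\mathbf p$ is a random point of the probability simplex with density $\frac{\Gamma(\alpha_0)}{\prod_i\Gamma(\alpha_i)}\prod_i p_i^{\alpha_i-1}$ with respect to Lebesgue measure in the first $K-1$ coordinates. Let $\operatorname H[Y\mid\mathbf p]=-\sum_{i=1}^K \mathbf p_i\log\mathbf p_i$ be the entropy of the categorical variable $Y\sim\operatorname{Cat}(\mathbf p)$. Write $\psi=\Gamma'/\Gamma$ for the digamma function, $\psi'$ for its derivative (the trigamma function), and $x^{\overline 2}=x(x+1)$ for the rising factorial. Then $\operatorname H[Y\mid\mathbf p]$ is square-integrable and $$ \begin{aligned} \operatorname{Var}\bigl[\operatorname H[Y\mid\mathbf p]\bigr] ={}&\sum_{i=1}^K\frac{\alpha_i^{\overline 2}}{\alpha_0^{\overline 2}}\Bigl(\psi'(\alpha_i+2)-\psi'(\alpha_0+2)+\bigl(\psi(\alpha_i+2)-\psi(\alpha_0+2)\bigr)^2\Bigr)\\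 &+\sum_{i\ne j}\frac{\alpha_i\alpha_j}{\alpha_0^{\overline 2}}\Bigl(-\psi'(\alpha_0+2)+\bigl(\psi(\alpha_i+1)-\psi(\alpha_0+2)\bigr)\bigl(\psi(\alpha_j+1)-\psi(\alpha_0+2)\bigr)\Bigr)\\ &-\sum_{i,j}\frac{\alpha_i\alpha_j}{\alpha_0^{2}}\bigl(\psi(\alpha_i+1)-\psi(\alpha_0+1)\bigr)\bigl(\psi(\alpha_j+1)-\psi(\alpha_0+1)\bigr), \end{aligned} $$ where $\sum_{i\ne j}$ runs over ordered pairs of distinct indices and $\alpha_0^2$ is the ordinary square. -/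

import Mathlib

open MeasureTheory ProbabilityTheory

/-- The digamma function `ψ = (log Γ)' = Γ' / Γ` of a real variable. -/
noncomputable def digamma (x : ℝ) : ℝ := logDeriv Real.Gamma x

/-- The trigamma function `ψ'`, the derivative of the digamma function. -/
noncomputable def trigamma (x : ℝ) : ℝ := deriv digamma x

/-- The rising factorial `x (x + 1) ⋯ (x + n - 1)`. -/
noncomputable def risingFactorial (x : ℝ) (n : ℕ) : ℝ := (ascPochhammer ℝ n).eval x

/-- The point of the hyperplane `∑ i, p i = 1` in `ℝ ^ (n + 1)` whose first `n` coordinates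
are the given ones. -/
noncomputable def simplexPoint {n : ℕ} (x : Fin n → ℝ) : Fin (n + 1) → ℝ :=
  Fin.snoc (α := fun _ => ℝ) x (1 - ∑ i, x i)

/-- The Dirichlet density `Γ(∑ αᵢ) / ∏ Γ(αᵢ) * ∏ pᵢ ^ (αᵢ - 1)` on the open probability simplex. -/
noncomputable def dirichletPDFReal {n : ℕ} (α p : Fin (n + 1) → ℝ) : ℝ :=
  Real.Gamma (∑ i, α i) / (∏ i, Real.Gamma (α i)) * ∏ i, p i ^ (α i - 1)

/-- The Dirichlet distribution `Dir(α)` on the probability simplex in `ℝ ^ (n + 1)`: it has density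
`dirichletPDFReal α` with respect to Lebesgue measure in the first `n` coordinates on the open
simplex. -/
noncomputable def dirichletMeasure {n : ℕ} (α : Fin (n + 1) → ℝ) : Measure (Fin (n + 1) → ℝ) :=
  Measure.map simplexPoint
    (((volume : Measure (Fin n → ℝ)).restrict {x | ∀ i, 0 < simplexPoint x i}).withDensity
      fun x => ENNReal.ofReal (dirichletPDFReal α (simplexPoint x)))

/-- The categorical distribution `Cat(p)`: outcome `y` has probability `p y`. -/
noncomputable def categorical {S : Type*} [Fintype S] [MeasurableSpace S] (p : S → ℝ) :
    Measure S :=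
  ∑ y, ENNReal.ofReal (p y) • Measure.dirac y

/-- The Shannon entropy `H[Y] = -∑ y, P(Y = y) log P(Y = y)` (natural logarithm) of a random
variable `Y` in a finite set with law `μ`. -/
noncomputable def shannonEntropy {S : Type*} [Fintype S] [MeasurableSpace S] (μ : Measure S) : ℝ :=
  -∑ y, μ.real {y} * Real.log (μ.real {y})

/-- `simplexPoint` is measurable, so that the push-forward in `dirichletMeasure` is not a junk
value. -/
theorem measurable_simplexPoint {n : ℕ} : Measurable (simplexPoint (n := n)) := by
  refine measurable_pi_lambda _ fun i => ?_
  refine Fin.lastCases ?_ (fun j => ?_) i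
  · simp only [simplexPoint, Fin.snoc_last]
    fun_prop
  · simp only [simplexPoint, Fin.snoc_castSucc]
    fun_prop

/-! Write `B(α) = ∏ Γ(αᵢ) / Γ(∑ αᵢ)`. Weighting `Dir(α)` by `∏ pᵢ ^ cᵢ` gives `B(α + c) / B(α)`
times `Dir(α + c)`, because the exponents add and `B` is the normalizing constant
(`lintegral_dirichletKernel`, `dirichletMeasure_withDensity_prod_rpow`). This is used twice.

With `c = eᵢ`, a factor `pᵢ` under the integral becomes the constant `αᵢ / α₀` and the shift `α ↦ α
+ eᵢ`. With `c` replaced by `t • c`, the moment generating function of `∑ cᵢ log pᵢ` is `B(α + t •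
c) / B(α)`. Its logarithm is a combination of values of `log Γ`, and two derivatives at `0` give the
first and second moments of the `log pᵢ` in terms of `ψ` and `ψ'`.

Expanding the variance into a double sum leaves the moments of `pᵢ log pᵢ` and of `pᵢ log pᵢ · pⱼ
log pⱼ`. One or two shifts reduce them to moments of logarithms. -/

/-! ### The Dirichlet integral, by stick breaking. -/

theorem lintegral_rpow_mul_one_sub_rpow {a b : ℝ} (ha : 0 < a) (hb : 0 < b) :
    ∫⁻ x in Set.Ioo (0 : ℝ) 1, ENNReal.ofReal (x ^ (a - 1) * (1 - x) ^ (b - 1)) =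
      ENNReal.ofReal (beta a b) := by
  have h := lintegral_betaPDF_eq_one ha hb
  have hB := beta_pos ha hb
  rw [lintegral_betaPDF] at h
  have h2 : ∀ x : ℝ, ENNReal.ofReal (x ^ (a - 1) * (1 - x) ^ (b - 1)) =
      ENNReal.ofReal (beta a b) *
        ENNReal.ofReal (1 / beta a b * x ^ (a - 1) * (1 - x) ^ (b - 1)) := by
    intro x
    rw [← ENNReal.ofReal_mul hB.le]
    congr 1
    field_simp
  simp_rw [h2]
  rw [lintegral_const_mul _ (by fun_prop), h, mul_one]

theorem sum_simplexPoint {n : ℕ} (x : Fin n → ℝ) : ∑ i, simplexPoint x i = 1 := by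
  rw [Fin.sum_univ_castSucc]
  simp [simplexPoint]

/-- Stick breaking: once `a` is split off, the remaining mass `1 - a` is distributed as a rescaled
point of the simplex one dimension lower. -/
theorem simplexPoint_cons {n : ℕ} (a : ℝ) (z : Fin n → ℝ) :
    simplexPoint (Fin.cons a ((1 - a) • z) : Fin (n + 1) → ℝ) =
      (Fin.cons a ((1 - a) • simplexPoint z) : Fin (n + 2) → ℝ) := by
  have h : (1 - a) • simplexPoint z =
      Fin.snoc (α := fun _ => ℝ) ((1 - a) • z) ((1 - a) * (1 - ∑ i, z i)) := by
    funext i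
    refine Fin.lastCases ?_ (fun j => ?_) i <;> simp [simplexPoint]
  rw [h, Fin.cons_snoc_eq_snoc_cons]
  unfold simplexPoint
  congr 1
  rw [Fin.sum_univ_succ]
  simp only [Fin.cons_zero, Fin.cons_succ, Pi.smul_apply, smul_eq_mul, ← Finset.mul_sum]
  ring

theorem lt_one_of_simplexPoint_pos {n : ℕ} {a : ℝ} {y : Fin n → ℝ}
    (h : ∀ i, 0 < simplexPoint (Fin.cons a y : Fin (n + 1) → ℝ) i) : 0 < a ∧ a < 1 := by
  have h0 : simplexPoint (Fin.cons a y : Fin (n + 1) → ℝ) 0 = a := by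
    rw [← Fin.castSucc_zero, simplexPoint, Fin.snoc_castSucc, Fin.cons_zero]
  have hs := sum_simplexPoint (Fin.cons a y : Fin (n + 1) → ℝ)
  rw [Fin.sum_univ_succ, h0] at hs
  have hp : 0 < ∑ i : Fin (n + 1), simplexPoint (Fin.cons a y : Fin (n + 1) → ℝ) i.succ :=
    Finset.sum_pos (fun i _ => h _) Finset.univ_nonempty
  exact ⟨h0 ▸ h 0, by linarith⟩

theorem measurableSet_simplex (n : ℕ) :
    MeasurableSet {x : Fin n → ℝ | ∀ i, 0 < simplexPoint x i} := by
  simp only [Set.ofPred_forall]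
  exact MeasurableSet.iInter fun i =>
    measurableSet_lt measurable_const ((measurable_pi_apply i).comp measurable_simplexPoint)

theorem lintegral_comp_smul_pi {n : ℕ} (f : (Fin n → ℝ) → ENNReal) (hf : Measurable f) {r : ℝ}
    (hr : 0 < r) :
    ∫⁻ y, f y = ENNReal.ofReal (r ^ n) * ∫⁻ z, f (r • z) := by
  have h := Measure.map_addHaar_smul (volume : Measure (Fin n → ℝ)) hr.ne'
  have h2 : ∫⁻ z, f (r • z) = ∫⁻ y, f y ∂(Measure.map (r • ·) (volume : Measure (Fin n → ℝ))) :=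
    (lintegral_map hf (measurable_const_smul r)).symm
  rw [h2, h, lintegral_smul_measure, smul_eq_mul, ← mul_assoc, ← ENNReal.ofReal_mul (by positivity)]
  have : r ^ n * |(r ^ Module.finrank ℝ (Fin n → ℝ))⁻¹| = 1 := by
    rw [Module.finrank_fin_fun, abs_of_pos (by positivity)]
    field_simp
  rw [this]
  simp

/-- The unnormalized Dirichlet density, extended by zero outside the open simplex. -/
noncomputable def dirichletKernel {n : ℕ} (α : Fin (n + 1) → ℝ) (x : Fin n → ℝ) : ENNReal :=
  {x : Fin n → ℝ | ∀ i, 0 < simplexPoint x i}.indicator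
    (fun x => ENNReal.ofReal (∏ i, simplexPoint x i ^ (α i - 1))) x

theorem measurable_dirichletKernel {n : ℕ} (α : Fin (n + 1) → ℝ) :
    Measurable (dirichletKernel α) := by
  refine Measurable.indicator ?_ (measurableSet_simplex n)
  refine ENNReal.measurable_ofReal.comp (Finset.measurable_prod _ fun i _ => ?_)
  exact ((measurable_pi_apply i).comp measurable_simplexPoint).pow_const _

theorem dirichletKernel_cons {n : ℕ} (α : Fin (n + 2) → ℝ) {a : ℝ} (h0 : 0 < a) (h1 : a < 1)
    (z : Fin n → ℝ) :
    dirichletKernel α (Fin.cons a ((1 - a) • z) : Fin (n + 1) → ℝ) =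
      ENNReal.ofReal (a ^ (α 0 - 1) * (1 - a) ^ (∑ i : Fin (n + 1), (α i.succ - 1))) *
        dirichletKernel (fun i => α i.succ) z := by
  have h1' : 0 < 1 - a := by linarith
  unfold dirichletKernel
  by_cases hz : ∀ i, 0 < simplexPoint z i
  · rw [Set.indicator_of_mem, Set.indicator_of_mem (by exact hz),
      ← ENNReal.ofReal_mul (by positivity), simplexPoint_cons, Fin.prod_univ_succ]
    · congr 1
      simp only [Fin.cons_zero, Fin.cons_succ, Pi.smul_apply, smul_eq_mul]
      rw [mul_assoc, Real.rpow_sum_of_pos h1', ← Finset.prod_mul_distrib]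
      congr 1
      exact Finset.prod_congr rfl fun i _ => Real.mul_rpow h1'.le (hz i).le
    · intro i
      rw [simplexPoint_cons]
      refine Fin.cases (by simpa using h0) (fun j => ?_) i
      simpa using mul_pos h1' (hz j)
  · rw [Set.indicator_of_notMem, Set.indicator_of_notMem (by exact hz), mul_zero]
    intro h
    refine hz fun i => ?_
    have := h i.succ
    rw [simplexPoint_cons] at this
    simp only [Fin.cons_succ, Pi.smul_apply, smul_eq_mul] at this
    exact (mul_pos_iff_of_pos_left h1').1 this

theorem lintegral_fin_cons {n : ℕ} (f : (Fin (n + 1) → ℝ) → ENNReal) (hf : Measurable f) :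
    ∫⁻ x, f x = ∫⁻ a : ℝ, ∫⁻ y : Fin n → ℝ, f (Fin.cons a y) := by
  have hm := (volume_preserving_piFinSuccAbove (fun _ : Fin (n + 1) => ℝ) 0).symm
  rw [← hm.lintegral_comp hf, Measure.volume_eq_prod,
    lintegral_prod _ (by fun_prop)]
  simp [MeasurableEquiv.piFinSuccAbove_symm_apply, Fin.insertNthEquiv]

/-- Induction on the dimension. Fixing the first coordinate `a` and substituting `y = (1 - a) • z`
separates the variables. The `z`-integral is the inductive hypothesis, and the `a`-integral is the
beta integral with parameters `α 0` and `A`. -/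
theorem lintegral_dirichletKernel {n : ℕ} (α : Fin (n + 1) → ℝ) (hα : ∀ i, 0 < α i) :
    ∫⁻ x, dirichletKernel α x =
      ENNReal.ofReal ((∏ i, Real.Gamma (α i)) / Real.Gamma (∑ i, α i)) := by
  induction n with
  | zero =>
    have : Real.Gamma (α 0) ≠ 0 := (Real.Gamma_pos_of_pos (hα 0)).ne'
    simp [dirichletKernel, simplexPoint, Fin.snoc, this, Measure.volume_pi_eq_dirac (0 : Fin 0 → ℝ)]
  | succ n ih =>
    set A := ∑ i : Fin (n + 1), α i.succ with hA
    have hApos : 0 < A := Finset.sum_pos (fun i _ => hα _) Finset.univ_nonempty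
    have hin : ∀ a : ℝ, ∫⁻ y : Fin n → ℝ, dirichletKernel α (Fin.cons a y : Fin (n + 1) → ℝ) =
        (Set.Ioo (0 : ℝ) 1).indicator (fun a =>
          ENNReal.ofReal (a ^ (α 0 - 1) * (1 - a) ^ (A - 1)) *
          ENNReal.ofReal ((∏ i : Fin (n + 1), Real.Gamma (α i.succ)) / Real.Gamma A)) a := by
      intro a
      by_cases ha : a ∈ Set.Ioo (0 : ℝ) 1
      · have h1' : 0 < 1 - a := by linarith [ha.2]
        have h0 := ha.1
        rw [Set.indicator_of_mem ha, lintegral_comp_smul_pi _ _ h1']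
        · simp_rw [dirichletKernel_cons α ha.1 ha.2]
          rw [lintegral_const_mul _ (measurable_dirichletKernel _), ih _ (fun i => hα _),
            ← mul_assoc, ← ENNReal.ofReal_mul (by positivity)]
          congr 2
          -- The Jacobian exponent `n` and the kernel exponent `A - (n + 1)` add up to `A - 1`.
          rw [mul_left_comm, ← Real.rpow_natCast, ← Real.rpow_add h1', Finset.sum_sub_distrib]
          simp only [Finset.sum_const, Finset.card_univ, Fintype.card_fin, nsmul_eq_mul, mul_one]
          push_cast
          congr 2
          ring
        · refine (measurable_dirichletKernel α).comp ?_
          refine measurable_pi_lambda _ fun i => ?_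
          refine Fin.cases (by simp) (fun j => ?_) i
          simpa using measurable_pi_apply j
      · rw [Set.indicator_of_notMem ha]
        refine (lintegral_congr fun y => ?_).trans lintegral_zero
        exact Set.indicator_of_notMem
          (fun h : ∀ i, 0 < simplexPoint _ i => ha (lt_one_of_simplexPoint_pos h)) _
    rw [lintegral_fin_cons _ (measurable_dirichletKernel α)]
    simp_rw [hin]
    rw [lintegral_indicator measurableSet_Ioo, lintegral_mul_const _ (by fun_prop),
      lintegral_rpow_mul_one_sub_rpow (hα 0) hApos, ← ENNReal.ofReal_mul (beta_pos (hα 0) hApos).le,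
      Fin.sum_univ_succ, Fin.prod_univ_succ fun i => Real.Gamma (α i), ← hA, beta]
    have := (Real.Gamma_pos_of_pos hApos).ne'
    congr 1
    field_simp

/-! ### Power weights as parameter shifts. -/

/-- The multivariate beta function `∏ Γ(αᵢ) / Γ(∑ αᵢ)`. -/
noncomputable def multiBeta {ι : Type*} [Fintype ι] (α : ι → ℝ) : ℝ :=
  (∏ i, Real.Gamma (α i)) / Real.Gamma (∑ i, α i)

theorem multiBeta_pos {n : ℕ} {α : Fin (n + 1) → ℝ} (hα : ∀ i, 0 < α i) : 0 < multiBeta α :=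
  div_pos (Finset.prod_pos fun i _ => Real.Gamma_pos_of_pos (hα i))
    (Real.Gamma_pos_of_pos (Finset.sum_pos (fun i _ => hα i) Finset.univ_nonempty))

theorem lintegral_dirichletMeasure {n : ℕ} {α : Fin (n + 1) → ℝ} (hα : ∀ i, 0 < α i)
    {f : (Fin (n + 1) → ℝ) → ENNReal} (hf : Measurable f) :
    ∫⁻ p, f p ∂dirichletMeasure α =
      ENNReal.ofReal (multiBeta α)⁻¹ * ∫⁻ x, dirichletKernel α x * f (simplexPoint x) := by
  have hm : Measurable fun x : Fin n → ℝ => ENNReal.ofReal (dirichletPDFReal α (simplexPoint x)) := by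
    refine ENNReal.measurable_ofReal.comp
      (measurable_const.mul (Finset.measurable_prod _ fun i _ => ?_))
    exact ((measurable_pi_apply i).comp measurable_simplexPoint).pow_const _
  have hfs : Measurable fun x : Fin n → ℝ => f (simplexPoint x) := hf.comp measurable_simplexPoint
  have hK : Measurable fun x => dirichletKernel α x * f (simplexPoint x) :=
    (measurable_dirichletKernel α).mul hfs
  rw [dirichletMeasure, lintegral_map hf measurable_simplexPoint,
    lintegral_withDensity_eq_lintegral_mul _ hm hfs,
    ← lintegral_const_mul _ hK,
    ← lintegral_indicator (measurableSet_simplex n)]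
  refine lintegral_congr fun x => ?_
  unfold dirichletKernel
  by_cases hx : ∀ i, 0 < simplexPoint x i
  · rw [Set.indicator_of_mem (by exact hx), Set.indicator_of_mem (by exact hx), ← mul_assoc,
      ← ENNReal.ofReal_mul (inv_pos.2 (multiBeta_pos hα)).le, Pi.mul_apply, multiBeta, inv_div]
    rfl
  · rw [Set.indicator_of_notMem (by exact hx), Set.indicator_of_notMem (by exact hx)]
    simp

theorem isProbabilityMeasure_dirichletMeasure {n : ℕ} {α : Fin (n + 1) → ℝ} (hα : ∀ i, 0 < α i) :
    IsProbabilityMeasure (dirichletMeasure α) := by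
  refine ⟨?_⟩
  have hB := multiBeta_pos hα
  rw [← lintegral_one, lintegral_dirichletMeasure hα measurable_const]
  simp only [mul_one]
  rw [lintegral_dirichletKernel α hα, ← multiBeta, ← ENNReal.ofReal_mul (inv_pos.2 hB).le,
    inv_mul_cancel₀ hB.ne', ENNReal.ofReal_one]

theorem ae_dirichletMeasure {n : ℕ} (α : Fin (n + 1) → ℝ) :
    ∀ᵐ p ∂dirichletMeasure α, (∀ i, 0 < p i) ∧ ∑ i, p i = 1 := by
  unfold dirichletMeasure
  refine (ae_map_iff measurable_simplexPoint.aemeasurable ?_).2 ?_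
  · refine MeasurableSet.inter (s₁ := {p : Fin (n + 1) → ℝ | ∀ i, 0 < p i}) ?_
      (measurableSet_eq_fun (by fun_prop) measurable_const)
    simp only [Set.ofPred_forall]
    exact MeasurableSet.iInter fun i => measurableSet_lt measurable_const (measurable_pi_apply i)
  · refine (withDensity_absolutelyContinuous _ _).ae_le ?_
    filter_upwards [ae_restrict_mem (measurableSet_simplex n)] with x hx
    exact ⟨hx, sum_simplexPoint x⟩

theorem dirichletKernel_mul_prod_rpow {n : ℕ} (α c : Fin (n + 1) → ℝ) (x : Fin n → ℝ) :
    dirichletKernel α x * ENNReal.ofReal (∏ i, simplexPoint x i ^ c i) =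
      dirichletKernel (α + c) x := by
  unfold dirichletKernel
  by_cases hx : ∀ i, 0 < simplexPoint x i
  · rw [Set.indicator_of_mem (by exact hx), Set.indicator_of_mem (by exact hx),
      ← ENNReal.ofReal_mul (Finset.prod_nonneg fun i _ => Real.rpow_nonneg (hx i).le _),
      ← Finset.prod_mul_distrib]
    congr 1
    refine Finset.prod_congr rfl fun i _ => ?_
    rw [← Real.rpow_add (hx i), Pi.add_apply]
    congr 1
    ring
  · rw [Set.indicator_of_notMem (by exact hx), Set.indicator_of_notMem (by exact hx), zero_mul]

theorem measurable_ofReal_prod_rpow {n : ℕ} (c : Fin (n + 1) → ℝ) :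
    Measurable fun p : Fin (n + 1) → ℝ => ENNReal.ofReal (∏ i, p i ^ c i) := by
  fun_prop

theorem dirichletMeasure_withDensity_prod_rpow {n : ℕ} {α c : Fin (n + 1) → ℝ}
    (hα : ∀ i, 0 < α i) (hc : ∀ i, 0 < α i + c i) :
    (dirichletMeasure α).withDensity (fun p => ENNReal.ofReal (∏ i, p i ^ c i)) =
      ENNReal.ofReal (multiBeta (α + c) / multiBeta α) • dirichletMeasure (α + c) := by
  refine Measure.ext_of_lintegral _ fun f hf => ?_
  have hB := multiBeta_pos hα
  have hB' : 0 < multiBeta (α + c) := multiBeta_pos hc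
  rw [lintegral_withDensity_eq_lintegral_mul _ (measurable_ofReal_prod_rpow c) hf,
    lintegral_dirichletMeasure hα ((measurable_ofReal_prod_rpow c).mul hf),
    lintegral_smul_measure, lintegral_dirichletMeasure (α := α + c) hc hf, smul_eq_mul, ← mul_assoc,
    ← ENNReal.ofReal_mul (by positivity)]
  congr 2
  · field_simp
  · funext x
    rw [Pi.mul_apply, ← mul_assoc, dirichletKernel_mul_prod_rpow]

/-- No integrability of `f` is needed: if it fails, both Bochner integrals are zero. -/
theorem integral_dirichletMeasure_prod_rpow_mul {n : ℕ} {α c : Fin (n + 1) → ℝ}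
    (hα : ∀ i, 0 < α i) (hc : ∀ i, 0 < α i + c i) (f : (Fin (n + 1) → ℝ) → ℝ) :
    ∫ p, (∏ i, p i ^ c i) * f p ∂dirichletMeasure α =
      multiBeta (α + c) / multiBeta α * ∫ p, f p ∂dirichletMeasure (α + c) := by
  have hB := multiBeta_pos hα
  have hB' : 0 < multiBeta (α + c) := multiBeta_pos hc
  have h := integral_withDensity_eq_integral_toReal_smul (μ := dirichletMeasure α)
    (measurable_ofReal_prod_rpow c) (Filter.Eventually.of_forall fun p => ENNReal.ofReal_lt_top) f
  rw [dirichletMeasure_withDensity_prod_rpow hα hc, integral_smul_measure,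
    ENNReal.toReal_ofReal (by positivity), smul_eq_mul] at h
  rw [h]
  refine integral_congr_ae ?_
  filter_upwards [ae_dirichletMeasure α] with p hp
  rw [ENNReal.toReal_ofReal (Finset.prod_nonneg fun i _ => Real.rpow_nonneg (hp.1 i).le _),
    smul_eq_mul]

theorem sum_add_single {n : ℕ} (α : Fin (n + 1) → ℝ) (i : Fin (n + 1)) :
    ∑ j, (α + Pi.single i 1 : Fin (n + 1) → ℝ) j = ∑ j, α j + 1 := by
  simp [Finset.sum_add_distrib]

theorem add_single_pos {n : ℕ} {α : Fin (n + 1) → ℝ} (hα : ∀ i, 0 < α i) (i j : Fin (n + 1)) :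
    0 < (α + Pi.single i 1 : Fin (n + 1) → ℝ) j :=
  add_pos_of_pos_of_nonneg (hα j) (by by_cases h : j = i <;> simp [h])

/-- `Γ(x + 1) = x Γ(x)` is applied to the `i`-th factor and to the denominator; the other factors
cancel. -/
theorem multiBeta_add_single {n : ℕ} {α : Fin (n + 1) → ℝ} (hα : ∀ i, 0 < α i)
    (i : Fin (n + 1)) :
    multiBeta (α + Pi.single i 1) / multiBeta α = α i / ∑ j, α j := by
  have hs : 0 < ∑ j, α j := Finset.sum_pos (fun i _ => hα i) Finset.univ_nonempty
  have hG := (Real.Gamma_pos_of_pos hs).ne'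
  have hP : (∏ j ∈ Finset.univ.erase i, Real.Gamma (α j)) ≠ 0 :=
    Finset.prod_ne_zero_iff.2 fun j _ => (Real.Gamma_pos_of_pos (hα j)).ne'
  have hi := (Real.Gamma_pos_of_pos (hα i)).ne'
  have hprod : ∏ j ∈ Finset.univ.erase i, Real.Gamma ((α + Pi.single i 1 : Fin (n + 1) → ℝ) j) =
      ∏ j ∈ Finset.univ.erase i, Real.Gamma (α j) := by
    refine Finset.prod_congr rfl fun j hj => ?_
    rw [Pi.add_apply, Pi.single_eq_of_ne (Finset.ne_of_mem_erase hj), add_zero]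
  unfold multiBeta
  rw [sum_add_single, ← Finset.mul_prod_erase _ _ (Finset.mem_univ i), hprod,
    ← Finset.mul_prod_erase Finset.univ (fun j => Real.Gamma (α j)) (Finset.mem_univ i),
    Pi.add_apply, Pi.single_eq_same, Real.Gamma_add_one hs.ne', Real.Gamma_add_one (hα i).ne']
  field_simp

theorem integral_dirichletMeasure_coord_mul {n : ℕ} {α : Fin (n + 1) → ℝ} (hα : ∀ i, 0 < α i)
    (i : Fin (n + 1)) (f : (Fin (n + 1) → ℝ) → ℝ) :
    ∫ p, p i * f p ∂dirichletMeasure α =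
      α i / (∑ j, α j) * ∫ p, f p ∂dirichletMeasure (α + Pi.single i 1) := by
  rw [← multiBeta_add_single hα, ← integral_dirichletMeasure_prod_rpow_mul hα (add_single_pos hα i)]
  congr 1
  funext p
  congr 1
  rw [Finset.prod_eq_single i (fun j _ hj => by rw [Pi.single_eq_of_ne hj, Real.rpow_zero])
    (by simp), Pi.single_eq_same, Real.rpow_one]

/-! ### Moments of the logarithms from the cumulant generating function. -/

theorem Real.analyticAt_Gamma {x : ℝ} (hx : 0 < x) : AnalyticAt ℝ Real.Gamma x := by
  have h : AnalyticAt ℂ Complex.Gamma (x : ℂ) := by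
    refine DifferentiableOn.analyticAt (s := {z : ℂ | 0 < z.re}) (fun z hz => ?_)
      ((isOpen_lt continuous_const Complex.continuous_re).mem_nhds (by simpa using hx))
    refine (Complex.differentiableAt_Gamma z fun m hm => ?_).differentiableWithinAt
    have hz' : 0 < z.re := hz
    rw [hm] at hz'
    simp only [Complex.neg_re, Complex.natCast_re] at hz'
    linarith [m.cast_nonneg (α := ℝ)]
  refine h.re_ofReal.congr (Filter.Eventually.of_forall fun y => ?_)
  simp [Complex.Gamma_ofReal]

theorem hasDerivAt_log_Gamma {x : ℝ} (hx : 0 < x) :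
    HasDerivAt (fun y => Real.log (Real.Gamma y)) (digamma x) x :=
  (Real.analyticAt_Gamma hx).differentiableAt.hasDerivAt.log (Real.Gamma_pos_of_pos hx).ne'

theorem hasDerivAt_digamma {x : ℝ} (hx : 0 < x) : HasDerivAt digamma (trigamma x) x :=
  ((Real.analyticAt_Gamma hx).deriv.div (Real.analyticAt_Gamma hx)
    (Real.Gamma_pos_of_pos hx).ne').differentiableAt.hasDerivAt

theorem ae_prod_rpow_eq_exp {n : ℕ} (α c : Fin (n + 1) → ℝ) (t : ℝ) :
    ∀ᵐ p ∂dirichletMeasure α,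
      ∏ i, p i ^ (t • c) i = Real.exp (t * ∑ i, c i * Real.log (p i)) := by
  filter_upwards [ae_dirichletMeasure α] with p hp
  rw [Finset.mul_sum, Real.exp_sum]
  refine Finset.prod_congr rfl fun i _ => ?_
  rw [Real.rpow_def_of_pos (hp.1 i), Pi.smul_apply, smul_eq_mul]
  congr 1
  ring

theorem mgf_sum_mul_log {n : ℕ} {α c : Fin (n + 1) → ℝ} (hα : ∀ i, 0 < α i) {t : ℝ}
    (ht : ∀ i, 0 < α i + t * c i) :
    mgf (fun p => ∑ i, c i * Real.log (p i)) (dirichletMeasure α) t =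
      multiBeta (α + t • c) / multiBeta α := by
  have hp := isProbabilityMeasure_dirichletMeasure (α := α + t • c) ht
  have h := integral_dirichletMeasure_prod_rpow_mul (c := t • c) hα ht fun _ => 1
  simp only [mul_one, integral_const, probReal_univ, smul_eq_mul] at h
  rw [← h, mgf]
  exact (integral_congr_ae (ae_prod_rpow_eq_exp α c t)).symm

theorem eventually_add_mul_pos {ι : Type*} [Finite ι] {α : ι → ℝ} (hα : ∀ i, 0 < α i)
    (c : ι → ℝ) : ∀ᶠ t : ℝ in nhds 0, ∀ i, 0 < α i + t * c i := by
  refine Filter.eventually_all.2 fun i => ?_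
  have h : ContinuousAt (fun t : ℝ => α i + t * c i) 0 := by fun_prop
  exact h.eventually (lt_mem_nhds (by simpa using hα i))

theorem zero_mem_interior_integrableExpSet_sum_mul_log {n : ℕ} {α : Fin (n + 1) → ℝ}
    (hα : ∀ i, 0 < α i) (c : Fin (n + 1) → ℝ) :
    0 ∈ interior (integrableExpSet (fun p => ∑ i, c i * Real.log (p i)) (dirichletMeasure α)) := by
  rw [mem_interior_iff_mem_nhds]
  filter_upwards [eventually_add_mul_pos hα c] with t ht
  -- A non-integrable function has Bochner integral `0`, so the positive closed form of the `mgf`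
  -- forces integrability.
  refine Integrable.of_integral_ne_zero ?_
  have h := mgf_sum_mul_log hα ht
  rw [mgf] at h
  rw [h]
  exact (div_pos (multiBeta_pos (α := α + t • c) ht) (multiBeta_pos hα)).ne'

theorem log_multiBeta {n : ℕ} {α : Fin (n + 1) → ℝ} (hα : ∀ i, 0 < α i) :
    Real.log (multiBeta α) =
      ∑ i, Real.log (Real.Gamma (α i)) - Real.log (Real.Gamma (∑ i, α i)) := by
  rw [multiBeta, Real.log_div, Real.log_prod]
  · exact fun i _ => (Real.Gamma_pos_of_pos (hα i)).ne'
  · exact Finset.prod_ne_zero_iff.2 fun i _ => (Real.Gamma_pos_of_pos (hα i)).ne'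
  · exact (Real.Gamma_pos_of_pos (Finset.sum_pos (fun i _ => hα i) Finset.univ_nonempty)).ne'

/-- The chain rule for a function separable in the coordinates and their sum, along a line. -/
theorem hasDerivAt_sum_sub_comp_line {n : ℕ} {f f' : ℝ → ℝ}
    (hf : ∀ x, 0 < x → HasDerivAt f (f' x) x) (α c w : Fin (n + 1) → ℝ) (v t : ℝ)
    (ht : ∀ i, 0 < α i + t * c i) :
    HasDerivAt (fun s => ∑ i, w i * f (α i + s * c i) - v * f (∑ i, (α i + s * c i)))
      (∑ i, w i * c i * f' (α i + t * c i) - v * (∑ i, c i) * f' (∑ i, (α i + t * c i))) t := by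
  have hline : ∀ i, HasDerivAt (fun s : ℝ => α i + s * c i) (c i) t := fun i => by
    simpa using ((hasDerivAt_id t).mul_const (c i)).const_add (α i)
  have h1 : ∀ i, HasDerivAt (fun s => w i * f (α i + s * c i))
      (w i * c i * f' (α i + t * c i)) t := fun i => by
    exact (((hf _ (ht i)).comp t (hline i)).const_mul (w i)).congr_deriv (by ring)
  have hs : HasDerivAt (fun s => ∑ i, (α i + s * c i)) (∑ i, c i) t :=
    HasDerivAt.fun_sum fun i _ => hline i
  have h2 : HasDerivAt (fun s => v * f (∑ i, (α i + s * c i)))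
      (v * (∑ i, c i) * f' (∑ i, (α i + t * c i))) t := by
    have hpos := Finset.sum_pos (fun i _ => ht i) (Finset.univ_nonempty (α := Fin (n + 1)))
    exact (HasDerivAt.const_mul v ((hf _ hpos).comp t hs)).congr_deriv (by ring)
  exact (HasDerivAt.fun_sum fun i _ => h1 i).sub h2

theorem deriv_cgf_sum_mul_log {n : ℕ} {α c : Fin (n + 1) → ℝ} (hα : ∀ i, 0 < α i) {t : ℝ}
    (ht : ∀ i, 0 < α i + t * c i) :
    HasDerivAt (cgf (fun p => ∑ i, c i * Real.log (p i)) (dirichletMeasure α))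
      (∑ i, c i * digamma (α i + t * c i) -
        (∑ i, c i) * digamma (∑ i, (α i + t * c i))) t := by
  have hd := hasDerivAt_sum_sub_comp_line (fun x hx => hasDerivAt_log_Gamma hx) α c 1 1 t ht
  have hev : ∀ᶠ s in nhds t, ∀ i, 0 < α i + s * c i := by
    refine Filter.eventually_all.2 fun i => ?_
    have h : ContinuousAt (fun s : ℝ => α i + s * c i) t := by fun_prop
    exact h.eventually (lt_mem_nhds (ht i))
  have heq : (fun s => (∑ i, (1 : Fin (n + 1) → ℝ) i * Real.log (Real.Gamma (α i + s * c i)) -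
      1 * Real.log (Real.Gamma (∑ i, (α i + s * c i)))) - Real.log (multiBeta α)) =ᶠ[nhds t]
      cgf (fun p => ∑ i, c i * Real.log (p i)) (dirichletMeasure α) := by
    filter_upwards [hev] with s hs
    have hs' : ∀ i, 0 < (α + s • c) i := hs
    rw [cgf, mgf_sum_mul_log hα hs, Real.log_div (multiBeta_pos hs').ne' (multiBeta_pos hα).ne',
      log_multiBeta hs']
    simp
  have := (hd.sub_const (Real.log (multiBeta α))).congr_of_eventuallyEq heq.symm
  simpa using this

theorem integral_sum_mul_log {n : ℕ} {α : Fin (n + 1) → ℝ} (hα : ∀ i, 0 < α i)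
    (c : Fin (n + 1) → ℝ) :
    ∫ p, ∑ i, c i * Real.log (p i) ∂dirichletMeasure α =
      ∑ i, c i * digamma (α i) - (∑ i, c i) * digamma (∑ i, α i) := by
  have := isProbabilityMeasure_dirichletMeasure hα
  have h := deriv_cgf_zero (zero_mem_interior_integrableExpSet_sum_mul_log hα c)
  rw [(deriv_cgf_sum_mul_log hα (t := 0) (by simpa using hα)).deriv] at h
  simpa using h.symm

theorem integral_sum_mul_log_sq {n : ℕ} {α : Fin (n + 1) → ℝ} (hα : ∀ i, 0 < α i)
    (c : Fin (n + 1) → ℝ) :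
    ∫ p, (∑ i, c i * Real.log (p i)) ^ 2 ∂dirichletMeasure α =
      ∑ i, c i ^ 2 * trigamma (α i) - (∑ i, c i) ^ 2 * trigamma (∑ i, α i) +
        (∑ i, c i * digamma (α i) - (∑ i, c i) * digamma (∑ i, α i)) ^ 2 := by
  have := isProbabilityMeasure_dirichletMeasure hα
  have h := iteratedDeriv_two_cgf (zero_mem_interior_integrableExpSet_sum_mul_log hα c)
  have h0 : ∀ i, 0 < α i + 0 * c i := by simpa using hα
  have heq : deriv (cgf (fun p => ∑ i, c i * Real.log (p i)) (dirichletMeasure α)) =ᶠ[nhds 0]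
      fun t => ∑ i, c i * digamma (α i + t * c i) -
        (∑ i, c i) * digamma (∑ i, (α i + t * c i)) := by
    filter_upwards [eventually_add_mul_pos hα c] with t ht
    exact (deriv_cgf_sum_mul_log hα ht).deriv
  -- The first derivative has the same separable shape, now with weights `c` and `∑ cᵢ`, so
  -- differentiating again squares these coefficients.
  rw [iteratedDeriv_succ, iteratedDeriv_one, heq.deriv_eq,
    (hasDerivAt_sum_sub_comp_line (fun x hx => hasDerivAt_digamma hx) α c c _ 0 h0).deriv,
    (deriv_cgf_sum_mul_log hα h0).deriv] at h
  simp only [zero_mul, add_zero, Real.exp_zero, mul_one, mgf_zero, div_one] at h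
  rw [eq_sub_iff_add_eq] at h
  rw [← h]
  simp only [sq]

theorem memLp_log_dirichletMeasure {n : ℕ} {α : Fin (n + 1) → ℝ} (hα : ∀ i, 0 < α i)
    (i : Fin (n + 1)) : MemLp (fun p : Fin (n + 1) → ℝ => Real.log (p i)) 2 (dirichletMeasure α) := by
  have h := memLp_of_mem_interior_integrableExpSet
    (zero_mem_interior_integrableExpSet_sum_mul_log hα (Pi.single i 1)) 2
  simpa [Pi.single_apply] using h

theorem integral_log_dirichletMeasure {n : ℕ} {α : Fin (n + 1) → ℝ} (hα : ∀ i, 0 < α i)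
    (i : Fin (n + 1)) :
    ∫ p, Real.log (p i) ∂dirichletMeasure α = digamma (α i) - digamma (∑ j, α j) := by
  simpa [Pi.single_apply] using integral_sum_mul_log hα (Pi.single i 1)

/-- Polarization: the quadratic formula at `eᵢ + eⱼ`, minus those at `eᵢ` and `eⱼ`, isolates the
mixed moment. -/
theorem integral_log_mul_log_dirichletMeasure {n : ℕ} {α : Fin (n + 1) → ℝ} (hα : ∀ i, 0 < α i)
    (i j : Fin (n + 1)) :
    ∫ p, Real.log (p i) * Real.log (p j) ∂dirichletMeasure α =
      (if i = j then trigamma (α i) else 0) - trigamma (∑ k, α k) +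
        (digamma (α i) - digamma (∑ k, α k)) * (digamma (α j) - digamma (∑ k, α k)) := by
  have hsq : ∀ k, ∫ p, Real.log (p k) ^ 2 ∂dirichletMeasure α =
      trigamma (α k) - trigamma (∑ k, α k) + (digamma (α k) - digamma (∑ k, α k)) ^ 2 := fun k => by
    have h := integral_sum_mul_log_sq hα (Pi.single k 1)
    simpa [Pi.single_apply] using h
  by_cases hij : i = j
  · subst hij
    simpa [← sq] using hsq i
  have hi := memLp_log_dirichletMeasure hα i
  have hj := memLp_log_dirichletMeasure hα j
  have h := integral_sum_mul_log_sq hα (Pi.single i 1 + Pi.single j 1)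
  -- As `i ≠ j`, the vector `eᵢ + eⱼ` has entries `0` and `1` only.
  have hc : ∀ k, (Pi.single i 1 + Pi.single j 1 : Fin (n + 1) → ℝ) k ^ 2 =
      (Pi.single i 1 + Pi.single j 1 : Fin (n + 1) → ℝ) k := fun k => by
    by_cases hk : k = i
    · subst hk; simp [hij]
    · by_cases hk' : k = j <;> simp [hk, hk', Ne.symm hij]
  simp only [hc] at h
  simp only [Pi.add_apply, add_mul, Finset.sum_add_distrib, Pi.single_apply, ite_mul, one_mul,
    zero_mul, Finset.sum_ite_eq', Finset.mem_univ, if_true, add_sq, mul_assoc] at h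
  have hint : Integrable (fun p : Fin (n + 1) → ℝ => Real.log (p i) * Real.log (p j))
    (dirichletMeasure α) := hi.integrable_mul hj
  have hadd : Integrable (fun p : Fin (n + 1) → ℝ =>
      Real.log (p i) ^ 2 + 2 * (Real.log (p i) * Real.log (p j))) (dirichletMeasure α) :=
    hi.integrable_sq.add (hint.const_mul 2)
  rw [integral_add hadd hj.integrable_sq,
    integral_add hi.integrable_sq (hint.const_mul 2), integral_const_mul, hsq, hsq] at h
  rw [if_neg hij]
  linarith

/-! ### Entropy and its variance. -/

theorem shannonEntropy_categorical {S : Type*} [Fintype S] [MeasurableSpace S]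
    [MeasurableSingletonClass S] {p : S → ℝ} (hp : ∀ i, 0 ≤ p i) :
    shannonEntropy (categorical p) = -∑ i, p i * Real.log (p i) := by
  classical
  have h : ∀ y, (categorical p).real {y} = p y := fun y => by
    rw [Measure.real, categorical, Measure.finsetSum_apply]
    simp only [Measure.smul_apply, Measure.dirac_apply' _ (measurableSet_singleton y), smul_eq_mul]
    rw [Finset.sum_eq_single y (fun b _ hb => by simp [hb]) (by simp)]
    simp [hp y]
  simp only [shannonEntropy, h]

theorem memLp_mul_log_dirichletMeasure {n : ℕ} {α : Fin (n + 1) → ℝ} (hα : ∀ i, 0 < α i)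
    (i : Fin (n + 1)) :
    MemLp (fun p : Fin (n + 1) → ℝ => p i * Real.log (p i)) 2 (dirichletMeasure α) := by
  have := isProbabilityMeasure_dirichletMeasure hα
  refine MemLp.of_bound (by fun_prop) 1 ?_
  filter_upwards [ae_dirichletMeasure α] with p hp
  have hle : p i ≤ 1 := hp.2 ▸ Finset.single_le_sum (fun j _ => (hp.1 j).le) (Finset.mem_univ i)
  rw [mul_comm, Real.norm_eq_abs]
  exact (Real.abs_log_mul_self_lt _ (hp.1 i) hle).le

theorem integral_mul_log_dirichletMeasure {n : ℕ} {α : Fin (n + 1) → ℝ} (hα : ∀ i, 0 < α i)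
    (i : Fin (n + 1)) :
    ∫ p, p i * Real.log (p i) ∂dirichletMeasure α =
      α i / (∑ j, α j) * (digamma (α i + 1) - digamma (∑ j, α j + 1)) := by
  rw [integral_dirichletMeasure_coord_mul hα, integral_log_dirichletMeasure (add_single_pos hα i),
    sum_add_single]
  simp

/-- Shifting by `eᵢ` and then `eⱼ` gives the constant `αᵢ (α + eᵢ)ⱼ / (α₀ (α₀ + 1))`. The second
shift sees `αᵢ + 1` exactly when `j = i`, which is where the two cases and the rising factorials
come from. -/
theorem integral_mul_log_mul_mul_log_dirichletMeasure {n : ℕ} {α : Fin (n + 1) → ℝ}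
    (hα : ∀ i, 0 < α i) (i j : Fin (n + 1)) :
    ∫ p, (p i * Real.log (p i)) * (p j * Real.log (p j)) ∂dirichletMeasure α =
      if i = j then
        risingFactorial (α i) 2 / risingFactorial (∑ k, α k) 2 *
          ((trigamma (α i + 2) - trigamma (∑ k, α k + 2)) +
            (digamma (α i + 2) - digamma (∑ k, α k + 2)) ^ 2)
      else
        α i * α j / risingFactorial (∑ k, α k) 2 *
          (-trigamma (∑ k, α k + 2) +
            (digamma (α i + 1) - digamma (∑ k, α k + 2)) *
              (digamma (α j + 1) - digamma (∑ k, α k + 2))) := by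
  have hs : 0 < ∑ k, α k := Finset.sum_pos (fun i _ => hα i) Finset.univ_nonempty
  have hrf : ∀ x, risingFactorial x 2 = x * (x + 1) := fun x => by
    simp [risingFactorial, ascPochhammer_succ_right]
  have h1 := add_single_pos hα i
  have h2 := add_single_pos h1 j
  have hs2 : ∑ k, (α + Pi.single i 1 + Pi.single j 1 : Fin (n + 1) → ℝ) k = ∑ k, α k + 2 := by
    rw [sum_add_single, sum_add_single, add_assoc, one_add_one_eq_two]
  have hre : ∀ p : Fin (n + 1) → ℝ, (p i * Real.log (p i)) * (p j * Real.log (p j)) =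
      p i * (p j * (Real.log (p i) * Real.log (p j))) := fun p => by ring
  simp_rw [hre]
  rw [integral_dirichletMeasure_coord_mul hα, integral_dirichletMeasure_coord_mul h1,
    integral_log_mul_log_dirichletMeasure h2, hs2, sum_add_single, hrf, hrf]
  have hs' : ∑ k, α k + 1 ≠ 0 := by positivity
  by_cases hij : i = j
  · subst hij
    simp only [if_true, Pi.add_apply, Pi.single_eq_same, add_assoc, one_add_one_eq_two]
    field_simp
  · simp only [if_neg hij, Pi.add_apply, Pi.single_eq_same, Pi.single_eq_of_ne hij,
      Pi.single_eq_of_ne (Ne.symm hij), add_zero, zero_sub]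
    field_simp

theorem variance_entropy_dirichletMeasure {n : ℕ} {α : Fin (n + 1) → ℝ} (hα : ∀ i, 0 < α i) :
    variance (fun p : Fin (n + 1) → ℝ => -∑ i, p i * Real.log (p i)) (dirichletMeasure α) =
      (∑ i, ∑ j, ∫ p, (p i * Real.log (p i)) * (p j * Real.log (p j)) ∂dirichletMeasure α) -
        ∑ i, ∑ j, (∫ p, p i * Real.log (p i) ∂dirichletMeasure α) *
          ∫ p, p j * Real.log (p j) ∂dirichletMeasure α := by
  have := isProbabilityMeasure_dirichletMeasure hα
  have hm := memLp_mul_log_dirichletMeasure hα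
  have hint : ∀ i j, Integrable (fun p : Fin (n + 1) → ℝ =>
      (p i * Real.log (p i)) * (p j * Real.log (p j))) (dirichletMeasure α) :=
    fun i j => (hm i).integrable_mul (hm j)
  rw [variance_fun_neg, variance_eq_sub (memLp_finsetSum _ fun i _ => hm i)]
  simp only [Pi.pow_apply]
  rw [integral_finsetSum _ fun i _ => (hm i).integrable one_le_two, sq, Finset.sum_mul_sum]
  simp_rw [sq, Finset.sum_mul_sum]
  rw [integral_finsetSum _ fun i _ => integrable_finsetSum _ fun j _ => hint i j]
  simp_rw [integral_finsetSum _ fun j _ => hint _ j]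

theorem mainTheorem3 {n : ℕ} (α : Fin (n + 1) → ℝ) (hα : ∀ i, 0 < α i)
    (α₀ : ℝ) (hα₀ : α₀ = ∑ i, α i)
    {Ω : Type*} [MeasurableSpace Ω] (P : Measure Ω)
    (p : Ω → Fin (n + 1) → ℝ) (hp : HasLaw p (dirichletMeasure α) P) :
    IsProbabilityMeasure P ∧
    MemLp (fun ω => shannonEntropy (categorical (p ω))) 2 P ∧
    variance (fun ω => shannonEntropy (categorical (p ω))) P =
      (∑ i, risingFactorial (α i) 2 / risingFactorial α₀ 2 *
        ((trigamma (α i + 2) - trigamma (α₀ + 2)) +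
          (digamma (α i + 2) - digamma (α₀ + 2)) ^ 2))
      + (∑ i, ∑ j ∈ Finset.univ.erase i, α i * α j / risingFactorial α₀ 2 *
          (-trigamma (α₀ + 2) +
            (digamma (α i + 1) - digamma (α₀ + 2)) * (digamma (α j + 1) - digamma (α₀ + 2))))
      - ∑ i, ∑ j, α i * α j / α₀ ^ 2 *
          ((digamma (α i + 1) - digamma (α₀ + 1)) * (digamma (α j + 1) - digamma (α₀ + 1))) := by
  subst hα₀
  have hD := isProbabilityMeasure_dirichletMeasure hα
  have hP := hp.isProbabilityMeasure
  -- Only almost everywhere: `categorical` truncates negative weights to `0`, so the formula is used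
  -- where `p ω` lies in the simplex.
  have hae : (fun ω => shannonEntropy (categorical (p ω))) =ᵐ[P]
      (fun q : Fin (n + 1) → ℝ => -∑ i, q i * Real.log (q i)) ∘ p := by
    have h := ae_dirichletMeasure α
    rw [← hp.map_eq] at h
    filter_upwards [ae_of_ae_map hp.aemeasurable h] with ω hω
    exact shannonEntropy_categorical fun i => (hω.1 i).le
  have hmem : MemLp (fun q : Fin (n + 1) → ℝ => -∑ i, q i * Real.log (q i)) 2
      (dirichletMeasure α) :=
    (memLp_finsetSum _ fun i _ => memLp_mul_log_dirichletMeasure hα i).neg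
  have hmeas : AEMeasurable (fun q : Fin (n + 1) → ℝ => -∑ i, q i * Real.log (q i))
      (P.map p) := by fun_prop
  refine ⟨hP, (memLp_congr_ae hae).2 ?_, ?_⟩
  · rw [← hp.map_eq] at hmem
    exact (memLp_map_measure_iff hmeas.aestronglyMeasurable hp.aemeasurable).1 hmem
  rw [variance_congr hae, ← variance_map hmeas hp.aemeasurable, hp.map_eq,
    variance_entropy_dirichletMeasure hα, ← Finset.sum_add_distrib]
  congr 1
  · refine Finset.sum_congr rfl fun i _ => ?_
    -- The diagonal term `j = i` is split off to match the first two sums.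
    rw [← Finset.add_sum_erase _ _ (Finset.mem_univ i),
      integral_mul_log_mul_mul_log_dirichletMeasure hα, if_pos rfl]
    congr 1
    refine Finset.sum_congr rfl fun j hj => ?_
    rw [integral_mul_log_mul_mul_log_dirichletMeasure hα, if_neg (Finset.ne_of_mem_erase hj).symm]
  · refine Finset.sum_congr rfl fun i _ => Finset.sum_congr rfl fun j _ => ?_
    rw [integral_mul_log_dirichletMeasure hα, integral_mul_log_dirichletMeasure hα]
    ring
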